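/- Rings are associative and unital. A row $(a_1,\dots,a_n)\in A^n$ over a ring $A$ is right unimodular if $\sum_{i=1}^n a_iA=A$. The stable rank $\operatorname{sr}(A)$ is the least positive integer $n$ such that for every right unimodular row $(a_1,\dots,a_n,b)\in A^{n+1}$ there are $c_1,\dots,c_n\in A$ for which $(a_1+bc_1,\dots,a_n+bc_n)$ is right unimodular; $\operatorname{sr}(A)=\infty$ if no such $n$ exists. **Theorem 9.** Let $A$ and $B$ be Morita equivalent rings, that is, rings whose categories of right modules are equivalent. Then $B\cong\operatorname{End}_A(P)$ for some finitely generated projective generator $P$ of the category of right $A$-modules. Moreover, for every finitely generated projective generator $P_A$ with $B\cong\operatorname{End}_A(P)$ the following hold. 1. If $P$ can be generated by $n$ elements as a right $A$-module, then $$\operatorname{sr}(A)\le n\cdot\operatorname{sr}(B)-n+1.$$ 2. If there are $t$ homomorphisms $f_1,\dots,f_t\in\operatorname{Hom}_A(P,A)$ such that $\sum_{i=1}^t f_i(P)=A$, then $$\operatorname{sr}(B)\le t\cdot\operatorname{sr}(A)-t+1.$$ -/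

import Mathlib

/-!
Right modules over a ring `A` are modules over the opposite ring `Aᵐᵒᵖ`; in particular `A` itself
carries the right regular module structure `MulOpposite.op r • a = a * r`.
-/

universe u v w

open scoped MulOpposite

namespace BassStableRank

/-- A row `(a₁, …, aₙ)` is right unimodular if `a₁ A + ⋯ + aₙ A = A`. -/
def IsRightUnimodular {A : Type u} [Ring A] {n : ℕ} (a : Fin n → A) : Prop :=
  Submodule.span Aᵐᵒᵖ (Set.range a) = ⊤

/-- A row `(a₁, …, aₙ, b)` is reducible if there are `c₁, …, cₙ` such that
`(a₁ + b c₁, …, aₙ + b cₙ)` is right unimodular. -/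
def IsReducible {A : Type u} [Ring A] {n : ℕ} (r : Fin (n + 1) → A) : Prop :=
  ∃ c : Fin n → A, IsRightUnimodular fun i : Fin n => r i.castSucc + r (Fin.last n) * c i

/-- The `n`-th stable range condition: all right unimodular `(n + 1)`-rows are reducible. -/
def StableRange (A : Type u) [Ring A] (n : ℕ) : Prop :=
  ∀ r : Fin (n + 1) → A, IsRightUnimodular r → IsReducible r

/-- The stable rank: the least positive integer `n` for which the `n`-th stable range condition
holds, or `∞` if there is none (the infimum of the empty set in `ℕ∞` is `⊤`). -/
noncomputable def sr (A : Type u) [Ring A] : ℕ∞ :=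
  sInf {m : ℕ∞ | ∃ n : ℕ, 1 ≤ n ∧ StableRange A n ∧ m = n}

/-- `P` is a generator of the category of right `A`-modules: the functor `Hom_A(P, -)` is faithful.
It is enough to test modules in the universe of `A`: the case `A → A ⧸ T`, with `T` the sum of the
images of all maps `P → A`, gives `T = A`, and this gives faithfulness in all universes. -/
def IsGenerator (A : Type u) [Ring A] (P : Type w) [AddCommGroup P] [Module Aᵐᵒᵖ P] : Prop :=
  ∀ (M N : Type u) [AddCommGroup M] [AddCommGroup N] [Module Aᵐᵒᵖ M] [Module Aᵐᵒᵖ N]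
    (f g : M →ₗ[Aᵐᵒᵖ] N), (∀ h : P →ₗ[Aᵐᵒᵖ] M, f ∘ₗ h = g ∘ₗ h) → f = g

/-- `P` is a finitely generated projective generator of the category of right `A`-modules. -/
structure IsProgenerator (A : Type u) [Ring A] (P : Type w) [AddCommGroup P] [Module Aᵐᵒᵖ P] :
    Prop where
  finite : Module.Finite Aᵐᵒᵖ P
  projective : Module.Projective Aᵐᵒᵖ P
  generator : IsGenerator A P

end BassStableRank

/-! For projective `U`, stable range `n` for `End U` is a property of modules: if `a : U^n → U` and
a submodule `L` together span `U`, then `a` can be changed by a map into `L` so as to become onto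
(`stableRange_end_iff`). This `Substitution` property adds up over targets (`Substitution.prod`),
survives enlarging the source (`Substitution.of_retract`) and permits cancelling a common summand
(`Substitution.of_prod_ker`).

Let `V ⊕ Q ≅ U^(k+1)` and let `U` be a summand of `V^t`. Stable range `s + 1` for `End U` gives
substitution from `U^(s+1+k)` to `U^(k+1)`. The source is `U^s ⊕ V ⊕ Q`, a summand of `V^(ts+1) ⊕
Q`; cancelling `Q` leaves stable range `ts + 1` for `End V` (`Substitution.of_retracts`). Both
inequalities are the cases `{U, V} = {A, P}`. -/

namespace BassStableRank

/-! ### Substitution property for projective modules -/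

section Substitution

variable {R : Type*} [Ring R]
  {M M' N N' F U V : Type*} [AddCommGroup M] [AddCommGroup M'] [AddCommGroup N] [AddCommGroup N']
  [AddCommGroup F] [AddCommGroup U] [AddCommGroup V]
  [Module R M] [Module R M'] [Module R N] [Module R N'] [Module R F] [Module R U] [Module R V]

/-- `a : M → N` can be corrected to a surjection by a map with values in `L`. -/
def IsCorrectable (a : M →ₗ[R] N) (L : Submodule R N) : Prop :=
  ∃ d : M →ₗ[R] N, (∀ m, d m ∈ L) ∧ Function.Surjective (a + d)

variable (R M N) in
/-- The substitution property: whenever `a : M → N` and a submodule `L` of `N` together span `N`,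
some map congruent to `a` modulo `L` is surjective. -/
def Substitution : Prop :=
  ∀ (a : M →ₗ[R] N) (L : Submodule R N), LinearMap.range a ⊔ L = ⊤ → IsCorrectable a L

variable (R M M') in
/-- `M` is a retract, that is, isomorphic to a direct summand, of `M'`. -/
def IsRetract : Prop :=
  ∃ (i : M →ₗ[R] M') (r : M' →ₗ[R] M), ∀ m, r (i m) = m

lemma IsRetract.of_equiv (e : M ≃ₗ[R] M') : IsRetract R M M' :=
  ⟨e, e.symm, fun m => by simp⟩

lemma IsRetract.trans (h : IsRetract R M M') (h' : IsRetract R M' N) : IsRetract R M N := by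
  obtain ⟨i, r, hr⟩ := h
  obtain ⟨j, s, hs⟩ := h'
  exact ⟨j ∘ₗ i, r ∘ₗ s, fun m => by simp [hs, hr]⟩

lemma IsRetract.prod (h : IsRetract R M M') (h' : IsRetract R N N') :
    IsRetract R (M × N) (M' × N') := by
  obtain ⟨i, r, hr⟩ := h
  obtain ⟨j, s, hs⟩ := h'
  exact ⟨i.prodMap j, r.prodMap s, fun m => by simp [hs, hr]⟩

lemma IsRetract.pi (ι : Type*) (h : IsRetract R M M') : IsRetract R (ι → M) (ι → M') := by
  obtain ⟨i, r, hr⟩ := h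
  exact ⟨i.compLeft ι, r.compLeft ι, fun m => funext fun k => by simp [hr]⟩

lemma IsRetract.pi_of_injective {ι κ : Type*} (g : κ → ι) (hg : Function.Injective g) :
    IsRetract R (κ → U) (ι → U) := by
  refine ⟨{ toFun := fun x => Function.extend g x 0, map_add' := ?_, map_smul' := ?_ },
    LinearMap.funLeft R U g, fun m => funext fun k => ?_⟩
  · intro x y
    rw [← Function.extend_add, add_zero]
  · intro c x
    simpa using Function.extend_smul c g x 0
  · simp [LinearMap.funLeft_apply, hg.extend_apply]

lemma IsRetract.of_surjective [Module.Projective R M] (f : M' →ₗ[R] M)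
    (hf : Function.Surjective f) : IsRetract R M M' := by
  obtain ⟨i, hi⟩ := f.exists_rightInverse_of_surjective (LinearMap.range_eq_top.2 hf)
  exact ⟨i, f, fun m => LinearMap.congr_fun hi m⟩

instance projective_pi_of_finite {ι : Type*} [Finite ι] [Module.Projective R U] :
    Module.Projective R (ι → U) := by
  classical
  have := Fintype.ofFinite ι
  exact Module.Projective.of_equiv' (R := R)
    (DFinsupp.linearEquivFunOnFintype (ι := ι) (M := fun _ => U))

lemma exists_lift_range [Module.Projective R M] (f : N →ₗ[R] N') (d : M →ₗ[R] N')
    (hd : ∀ m, d m ∈ LinearMap.range f) : ∃ c : M →ₗ[R] N, ∀ m, f (c m) = d m := by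
  obtain ⟨c, hc⟩ := Module.projective_lifting_property f.rangeRestrict
    (d.codRestrict (LinearMap.range f) hd) f.surjective_rangeRestrict
  exact ⟨c, fun m => congrArg Subtype.val (LinearMap.congr_fun hc m)⟩

lemma exists_lift_map [Module.Projective R M] (f : N →ₗ[R] N') (L : Submodule R N)
    (d : M →ₗ[R] N') (hd : ∀ m, d m ∈ L.map f) :
    ∃ c : M →ₗ[R] N, (∀ m, c m ∈ L) ∧ ∀ m, f (c m) = d m := by
  obtain ⟨c, hc⟩ := exists_lift_range (f ∘ₗ L.subtype) d fun m => by
    simpa [LinearMap.range_comp] using hd m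
  exact ⟨L.subtype ∘ₗ c, fun m => (c m).2, hc⟩

lemma exists_add_of_mem_sup [Module.Projective R M] (L L' : Submodule R N) (d : M →ₗ[R] N)
    (hd : ∀ m, d m ∈ L ⊔ L') :
    ∃ c c' : M →ₗ[R] N, (∀ m, c m ∈ L) ∧ (∀ m, c' m ∈ L') ∧ ∀ m, c m + c' m = d m := by
  obtain ⟨c, hc⟩ := exists_lift_range (L.subtype.coprod L'.subtype) d fun m => by
    simpa [LinearMap.range_coprod] using hd m
  exact ⟨L.subtype ∘ₗ LinearMap.fst R L L' ∘ₗ c, L'.subtype ∘ₗ LinearMap.snd R L L' ∘ₗ c,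
    fun m => (c m).1.2, fun m => (c m).2.2, fun m => by simpa using hc m⟩

lemma Substitution.of_subsingleton [Subsingleton N] : Substitution R M N := fun _ _ _ =>
  ⟨0, fun _ => Submodule.zero_mem _, fun _ => ⟨0, Subsingleton.elim _ _⟩⟩

/-- Values in `a (ker r)` may be used freely: they are attained by moving the argument within `ker
r`, where `r`, and so the correction, does not see the move. -/
lemma Substitution.of_retract [Module.Projective R M] (h : Substitution R M N)
    (hM : IsRetract R M M') : Substitution R M' N := by
  obtain ⟨i, r, hr⟩ := hM
  intro a L hL
  obtain ⟨d, hd, hs⟩ := h (a ∘ₗ i) (L ⊔ (LinearMap.ker r).map a) (by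
    refine top_le_iff.1 (hL.ge.trans (sup_le ?_ (le_sup_left.trans le_sup_right)))
    rintro _ ⟨m, rfl⟩
    have : a m = a (i (r m)) + a (m - i (r m)) := by rw [← map_add]; congr 1; abel
    rw [this]
    refine Submodule.add_mem_sup ⟨r m, rfl⟩ (Submodule.mem_sup_right ⟨_, ?_, rfl⟩)
    simp [hr])
  obtain ⟨c, c', hc, hc', hcc⟩ := exists_add_of_mem_sup _ _ d hd
  obtain ⟨k, hk, hk'⟩ := exists_lift_map a _ c' hc'
  refine ⟨c ∘ₗ r, fun m => hc _, fun n => ?_⟩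
  obtain ⟨m, rfl⟩ := hs n
  have : r (k m) = 0 := hk m
  refine ⟨i m + k m, ?_⟩
  simp [hr, this, hk', ← hcc]
  abel

lemma Substitution.congr_right (h : Substitution R M N) (e : N ≃ₗ[R] N') :
    Substitution R M N' := by
  intro a L hL
  obtain ⟨d, hd, hs⟩ := h (e.symm.toLinearMap ∘ₗ a) (L.map e.symm.toLinearMap) (by
    rw [LinearMap.range_comp, ← Submodule.map_sup, hL, Submodule.map_top, LinearEquiv.range])
  refine ⟨e.toLinearMap ∘ₗ d, fun m => ?_, fun n => ?_⟩
  · obtain ⟨l, hl, hlm⟩ := hd m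
    have : d m = e.symm l := hlm.symm
    simpa [this] using hl
  · obtain ⟨m, hm⟩ := hs (e.symm n)
    refine ⟨m, e.symm.injective ?_⟩
    rw [← hm]
    simp

lemma IsCorrectable.of_comp_equiv {a : M →ₗ[R] N} {L : Submodule R N} (e : M' ≃ₗ[R] M)
    (h : IsCorrectable (a ∘ₗ e.toLinearMap) L) : IsCorrectable a L := by
  obtain ⟨d, hd, hs⟩ := h
  refine ⟨d ∘ₗ e.symm.toLinearMap, fun m => hd _, fun n => ?_⟩
  obtain ⟨m, hm⟩ := hs n
  exact ⟨e m, by simpa using hm⟩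

lemma IsCorrectable.of_add {a d : M →ₗ[R] N} {L : Submodule R N} (hd : ∀ m, d m ∈ L)
    (h : IsCorrectable (a + d) L) : IsCorrectable a L := by
  obtain ⟨d', hd', hs⟩ := h
  exact ⟨d + d', fun m => L.add_mem (hd m) (hd' m), by rwa [← add_assoc]⟩

lemma range_add_sup {a d : M →ₗ[R] N} {L : Submodule R N} (hd : ∀ m, d m ∈ L)
    (h : LinearMap.range a ⊔ L = ⊤) : LinearMap.range (a + d) ⊔ L = ⊤ := by
  refine top_le_iff.1 (h.ge.trans (sup_le ?_ le_sup_right))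
  rintro _ ⟨m, rfl⟩
  have : a m = (a + d) m + -d m := by simp
  rw [this]
  exact Submodule.add_mem_sup ⟨m, rfl⟩ (L.neg_mem (hd m))

/-- The automorphism `(m, f) ↦ (m, f + c m)` of `M × F`. -/
def shearRight (c : M →ₗ[R] F) : (M × F) ≃ₗ[R] M × F :=
  LinearEquiv.ofLinearMap
    ((LinearMap.fst R M F).prod (LinearMap.snd R M F + c ∘ₗ LinearMap.fst R M F))
    ((LinearMap.fst R M F).prod (LinearMap.snd R M F - c ∘ₗ LinearMap.fst R M F))
    (LinearMap.ext fun x => by simp) (LinearMap.ext fun x => by simp)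

@[simp]
lemma shearRight_apply (c : M →ₗ[R] F) (x : M × F) : shearRight c x = (x.1, x.2 + c x.1) := rfl

/-- The automorphism `(m, f) ↦ (m + v f, f)` of `M × F`. -/
def shearLeft (v : F →ₗ[R] M) : (M × F) ≃ₗ[R] M × F :=
  LinearEquiv.ofLinearMap
    ((LinearMap.fst R M F + v ∘ₗ LinearMap.snd R M F).prod (LinearMap.snd R M F))
    ((LinearMap.fst R M F - v ∘ₗ LinearMap.snd R M F).prod (LinearMap.snd R M F))
    (LinearMap.ext fun x => by simp) (LinearMap.ext fun x => by simp)

@[simp]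
lemma shearLeft_apply (v : F →ₗ[R] M) (x : M × F) : shearLeft v x = (x.1 + v x.2, x.2) := rfl

lemma range_comp_equiv_sup {a : M →ₗ[R] N} {L : Submodule R N} (e : M' ≃ₗ[R] M)
    (h : LinearMap.range a ⊔ L = ⊤) : LinearMap.range (a ∘ₗ e.toLinearMap) ⊔ L = ⊤ := by
  rwa [LinearMap.range_comp_of_range_eq_top _ (LinearEquiv.range e)]

/-- Here `a` is block triangular with identity on `F`. The map `φ` kills `a (F)` and turns `a` into
its corner `α`; a correction of `α` lifts along `φ` to `L`. -/
lemma isCorrectable_of_snd [Module.Projective R M] (hN : Substitution R M N)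
    {a : M × F →ₗ[R] N × F} {L : Submodule R (N × F)} (hL : LinearMap.range a ⊔ L = ⊤)
    (ha : ∀ x, (a x).2 = x.2) : IsCorrectable a L := by
  let β : F →ₗ[R] N := LinearMap.fst R N F ∘ₗ a ∘ₗ LinearMap.inr R M F
  let α : M →ₗ[R] N := LinearMap.fst R N F ∘ₗ a ∘ₗ LinearMap.inl R M F
  let φ : N × F →ₗ[R] N := LinearMap.fst R N F - β ∘ₗ LinearMap.snd R N F
  have haα : ∀ m f, (a (m, f)).1 = α m + β f := fun m f => by
    have : (m, f) = (m, (0 : F)) + ((0 : M), f) := by simp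
    rw [this, map_add]; rfl
  obtain ⟨d, hd, hs⟩ := hN α (L.map φ) (by
    refine Submodule.eq_top_iff'.2 fun n => ?_
    obtain ⟨_, ⟨⟨m, f⟩, rfl⟩, l, hl, hml⟩ := Submodule.mem_sup.1 (hL.ge (x := (n, 0)) trivial)
    have h1 := congrArg Prod.fst hml
    have h2 := congrArg Prod.snd hml
    simp only [Prod.fst_add, Prod.snd_add, haα, ha] at h1 h2
    refine Submodule.mem_sup.2 ⟨α m, ⟨m, rfl⟩, φ l, ⟨l, hl, rfl⟩, ?_⟩
    have hf : f = -l.2 := eq_neg_of_add_eq_zero_left h2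
    rw [← h1, hf]
    simp [φ]
    abel)
  obtain ⟨c, hc, hc'⟩ := exists_lift_map φ L d hd
  refine ⟨c ∘ₗ LinearMap.fst R M F, fun m => hc _, fun ⟨n, x⟩ => ?_⟩
  obtain ⟨m, hm⟩ := hs (n - β x)
  refine ⟨(m, x - (c m).2), Prod.ext ?_ ?_⟩
  · have h3 := hc' m
    simp only [LinearMap.add_apply, ← h3] at hm
    simp only [LinearMap.add_apply, LinearMap.comp_apply, Prod.fst_add, haα,
      LinearMap.fst_apply, map_sub]
    have h4 : φ (c m) = (c m).1 - β (c m).2 := rfl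
    rw [h4] at hm
    rw [eq_sub_iff_add_eq] at hm
    rw [← hm]
    abel
  · simp [ha]

lemma isCorrectable_of_surjective_snd_inl [Module.Projective R M] [Module.Projective R F]
    (hN : Substitution R M N) {a : M × F →ₗ[R] N × F} {L : Submodule R (N × F)}
    (hL : LinearMap.range a ⊔ L = ⊤)
    (ha : Function.Surjective (LinearMap.snd R N F ∘ₗ a ∘ₗ LinearMap.inl R M F)) :
    IsCorrectable a L := by
  set γ : M →ₗ[R] F := LinearMap.snd R N F ∘ₗ a ∘ₗ LinearMap.inl R M F
  set δ : F →ₗ[R] F := LinearMap.snd R N F ∘ₗ a ∘ₗ LinearMap.inr R M F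
  have haγ : ∀ m f, (a (m, f)).2 = γ m + δ f := fun m f => by
    have : (m, f) = (m, (0 : F)) + ((0 : M), f) := by simp
    rw [this, map_add]; rfl
  -- Since `γ v + δ = 1`, two shears of the source turn the second component into the projection to
  -- `F`.
  obtain ⟨v, hv⟩ := Module.projective_lifting_property γ (LinearMap.id - δ) ha
  refine .of_comp_equiv ((shearRight (-γ)).trans (shearLeft v))
    (isCorrectable_of_snd hN (range_comp_equiv_sup _ hL) fun ⟨m, f⟩ => ?_)
  have hv' : ∀ f, γ (v f) = f - δ f := fun f => LinearMap.congr_fun hv f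
  simp [haγ, hv']
  abel

lemma Substitution.prod [Module.Projective R M] [Module.Projective R F]
    (hF : Substitution R M F) (hN : Substitution R M N) :
    Substitution R (M × F) (N × F) := by
  intro a L hL
  set γ : M →ₗ[R] F := LinearMap.snd R N F ∘ₗ a ∘ₗ LinearMap.inl R M F
  set δ : F →ₗ[R] F := LinearMap.snd R N F ∘ₗ a ∘ₗ LinearMap.inr R M F
  have haγ : ∀ m f, (a (m, f)).2 = γ m + δ f := fun m f => by
    have : (m, f) = (m, (0 : F)) + ((0 : M), f) := by simp
    rw [this, map_add]; rfl
  -- Make `γ` onto `F`: the part of the correction in `range δ` is realised by a shear of the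
  -- source, the part coming from `L` by an admissible change of `a`.
  obtain ⟨d, hd, hs⟩ := hF γ (LinearMap.range δ ⊔ L.map (LinearMap.snd R N F)) (by
    refine Submodule.eq_top_iff'.2 fun x => ?_
    obtain ⟨_, ⟨⟨m, f⟩, rfl⟩, l, hl, hml⟩ := Submodule.mem_sup.1 (hL.ge (x := (0, x)) trivial)
    have h2 := congrArg Prod.snd hml
    simp only [Prod.snd_add, haγ] at h2
    rw [← h2, add_assoc]
    exact Submodule.add_mem_sup ⟨m, rfl⟩ (Submodule.add_mem_sup ⟨f, rfl⟩ ⟨l, hl, rfl⟩))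
  obtain ⟨c, c', hc, hc', hcc⟩ := exists_add_of_mem_sup _ _ d hd
  obtain ⟨k, hk⟩ := exists_lift_range δ c hc
  obtain ⟨l, hl, hl'⟩ := exists_lift_map _ L c' hc'
  refine .of_add (d := l ∘ₗ LinearMap.fst R M F) (fun x => hl _)
    (.of_comp_equiv (shearRight k) (isCorrectable_of_surjective_snd_inl hN
      (range_comp_equiv_sup _ (range_add_sup (fun x => hl _) hL)) fun x => ?_))
  obtain ⟨m, hm⟩ := hs x
  refine ⟨m, ?_⟩
  have hl'' : (l m).2 = c' m := hl' m
  simp [haγ, hk, hl'', ← hm, ← hcc]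
  abel

/-- Pad `a` by the inclusion of `ker r`. Corrections lie in `i (L)`, so a preimage of `i n` has zero
component in `ker r`, and `M` alone reaches `n`. -/
lemma Substitution.of_prod_ker {i : N →ₗ[R] N'} {r : N' →ₗ[R] N} (hr : ∀ n, r (i n) = n)
    (h : Substitution R (M × LinearMap.ker r) N') : Substitution R M N := by
  intro a L hL
  obtain ⟨d, hd, hs⟩ := h ((i ∘ₗ a).coprod (LinearMap.ker r).subtype) (L.map i) (by
    refine Submodule.eq_top_iff'.2 fun n => ?_
    obtain ⟨_, ⟨m, rfl⟩, l, hl, hml⟩ := Submodule.mem_sup.1 (hL.ge (x := r n) trivial)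
    refine Submodule.mem_sup.2 ⟨_, ⟨(m, ⟨n - i (r n), by simp [hr]⟩), rfl⟩, i l, ⟨l, hl, rfl⟩, ?_⟩
    simp [← hml]
    abel)
  refine ⟨r ∘ₗ d ∘ₗ LinearMap.inl R M _, fun m => ?_, fun n => ?_⟩
  · obtain ⟨l, hl, hlm⟩ := hd (m, 0)
    simpa [← hlm, hr] using hl
  · obtain ⟨⟨m, q⟩, hq⟩ := hs (i n)
    have hq0 : r q = 0 := q.2
    obtain ⟨l, -, hl⟩ := hd (m, q)
    have h1 : i (a m) + q + i l = i n := by simpa [hl] using hq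
    have h2 : a m + l = n := by simpa [hr, hq0] using congrArg r h1
    have h3 : q = 0 := by
      rw [← h2] at h1
      ext
      simpa [add_right_comm] using h1
    subst h3
    refine ⟨m, ?_⟩
    simp [← hl, hr, h2]

lemma Substitution.pi_succ [Module.Projective R U] {s : ℕ} (h : Substitution R (Fin s → U) U)
    (k : ℕ) : Substitution R (Fin (s + k) → U) (Fin (k + 1) → U) := by
  induction k with
  | zero => exact h.congr_right (LinearEquiv.funUnique (Fin 1) R U).symm
  | succ k ih =>
    have hU : Substitution R (Fin (s + k) → U) U :=
      h.of_retract (.pi_of_injective (Fin.castAdd k) (Fin.castAdd_injective _ _))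
    have e (n : ℕ) : ((Fin n → U) × U) ≃ₗ[R] (Fin (n + 1) → U) :=
      (LinearEquiv.prodComm R _ _).trans (Fin.consLinearEquiv R fun _ : Fin (n + 1) => U)
    exact ((hU.prod ih).of_retract (.of_equiv (e _))).congr_right (e _)

/-- The substitution property passes from powers of `U` to powers of `V` if each of the
projective modules `U`, `V` is a direct summand of a power of the other. -/
theorem Substitution.of_retracts [Module.Projective R U] {s k t : ℕ}
    (h : Substitution R (Fin (s + 1) → U) U) (hV : IsRetract R V (Fin k → U))
    (hU : IsRetract R U (Fin t → V)) : Substitution R (Fin (t * s + 1) → V) V := by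
  -- One extra copy of `U` matches the exponent `k + 1` of `pi_succ`.
  obtain ⟨i, r, hr⟩ :=
    hV.trans (IsRetract.pi_of_injective Fin.castSucc (Fin.castSucc_injective k))
  refine .of_prod_ker hr ((h.pi_succ k).of_retract ?_)
  have h1 : IsRetract R (Fin (s + 1 + k) → U) ((Fin s → U) × (Fin (k + 1) → U)) :=
    .of_equiv ((LinearEquiv.funCongrLeft R U (finSumFinEquiv.trans
      (finCongr (by omega : s + (k + 1) = s + 1 + k)))).trans
      (LinearEquiv.sumArrowLequivProdArrow _ _ R U))
  have h2 : IsRetract R (Fin (k + 1) → U) (V × LinearMap.ker r) := by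
    refine ⟨r.prod ((LinearMap.id - i ∘ₗ r).codRestrict _ fun x => by simp [hr]),
      i.coprod (LinearMap.ker r).subtype, fun x => by simp⟩
  have h3 : IsRetract R (Fin s → U) (Fin s → Fin t → V) := hU.pi _
  have h4 : IsRetract R ((Fin s → Fin t → V) × V) (Fin (t * s + 1) → V) := by
    refine .trans (.prod (.of_equiv (LinearEquiv.curry R V (Fin s) (Fin t)).symm)
      (.of_equiv (LinearEquiv.funUnique (Fin 1) R V).symm)) ?_
    refine .trans (.of_equiv (LinearEquiv.sumArrowLequivProdArrow _ _ R V).symm) ?_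
    exact .of_equiv (LinearEquiv.funCongrLeft R V (Fintype.equivOfCardEq (by simp [mul_comm])))
  exact (h1.trans (h3.prod h2)).trans
    ((IsRetract.of_equiv (LinearEquiv.prodAssoc R _ _ _).symm).trans
      (h4.prod (.of_equiv (LinearEquiv.refl R _))))

end Substitution

/-! ### Unimodular rows and endomorphism rings -/

lemma isRightUnimodular_iff {A : Type u} [Ring A] {n : ℕ} (a : Fin n → A) :
    IsRightUnimodular a ↔ ∃ c : Fin n → A, ∑ i, a i * c i = 1 := by
  have h : IsRightUnimodular a ↔ (1 : A) ∈ Submodule.span Aᵐᵒᵖ (Set.range a) := by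
    refine ⟨fun h => h.ge trivial, fun h => Submodule.eq_top_iff'.2 fun x => ?_⟩
    simpa using Submodule.smul_mem _ (MulOpposite.op x) h
  rw [h, Submodule.mem_span_range_iff_exists_fun]
  constructor
  · rintro ⟨c, hc⟩
    exact ⟨fun i => (c i).unop, by simpa [MulOpposite.smul_eq_mul_unop] using hc⟩
  · rintro ⟨c, hc⟩
    exact ⟨fun i => MulOpposite.op (c i), by simpa using hc⟩

lemma IsRightUnimodular.map {A : Type u} {B : Type v} [Ring A] [Ring B] (e : A →+* B) {n : ℕ}
    {a : Fin n → A} (h : IsRightUnimodular a) : IsRightUnimodular fun i => e (a i) := by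
  rw [isRightUnimodular_iff] at h ⊢
  obtain ⟨c, hc⟩ := h
  exact ⟨fun i => e (c i), by simpa using congrArg e hc⟩

lemma StableRange.of_ringEquiv {A : Type u} {B : Type v} [Ring A] [Ring B] (e : A ≃+* B) {n : ℕ}
    (h : StableRange A n) : StableRange B n := by
  intro r hr
  obtain ⟨c, hc⟩ := h (fun i => e.symm (r i)) (hr.map e.symm.toRingHom)
  exact ⟨fun i => e (c i), by simpa using hc.map e.toRingHom⟩

lemma StableRange.of_subsingleton {A : Type u} [Ring A] [Subsingleton A] (n : ℕ) :
    StableRange A n := fun _ _ =>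
  ⟨0, (isRightUnimodular_iff _).2 ⟨0, Subsingleton.elim _ _⟩⟩

section Endomorphisms

variable {R : Type*} [Ring R] {U : Type*} [AddCommGroup U] [Module R U]

lemma isRightUnimodular_end_iff [Module.Projective R U] {n : ℕ} (a : Fin n → Module.End R U) :
    IsRightUnimodular a ↔ Function.Surjective (LinearMap.lsum R (fun _ => U) ℕ a) := by
  rw [isRightUnimodular_iff]
  constructor
  · rintro ⟨c, hc⟩ u
    exact ⟨fun i => c i u, by simpa using LinearMap.congr_fun hc u⟩
  · intro h
    obtain ⟨c, hc⟩ := Module.projective_lifting_property _ LinearMap.id h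
    refine ⟨fun i => LinearMap.proj i ∘ₗ c, LinearMap.ext fun u => ?_⟩
    simpa using LinearMap.congr_fun hc u

lemma sum_map_single {n : ℕ} (a : (Fin n → U) →ₗ[R] U) (x : Fin n → U) :
    ∑ i, a (Pi.single i (x i)) = a x := by
  rw [← map_sum, Finset.univ_sum_single]

/-- For a projective module, the stable range condition on its endomorphism ring is a
substitution property. -/
theorem stableRange_end_iff [Module.Projective R U] (n : ℕ) :
    StableRange (Module.End R U) n ↔ Substitution R (Fin n → U) U := by
  constructor
  · intro h a L hL
    -- A splitting of `U^n ⊕ L → U` completes `a` to a unimodular row whose last entry `b` has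
    -- values in `L`, so that every `b * d i` does too.
    obtain ⟨c, hc⟩ := Module.projective_lifting_property (a.coprod L.subtype) LinearMap.id
      (LinearMap.range_eq_top.1 (by simpa [LinearMap.range_coprod] using hL))
    let b : Module.End R U := L.subtype ∘ₗ LinearMap.snd R _ _ ∘ₗ c
    have hb : ∀ u, b u ∈ L := fun u => ((c u).2).2
    let r : Fin n → Module.End R U := fun i => a ∘ₗ LinearMap.single R (fun _ => U) i
    have hr : ∀ x, ∑ i, r i (x i) = a x := sum_map_single a
    obtain ⟨d, hd⟩ := h (Fin.snoc r b) ((isRightUnimodular_end_iff _).2 fun u =>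
      ⟨Fin.snoc (c u).1 u, by
        have h1 : a (c u).1 + b u = u := LinearMap.congr_fun hc u
        simpa [Fin.sum_univ_castSucc, hr] using h1⟩)
    rw [isRightUnimodular_end_iff] at hd
    refine ⟨LinearMap.lsum R (fun _ => U) ℕ fun i => b * d i, fun m => ?_, fun u => ?_⟩
    · simpa using L.sum_mem fun i _ => hb _
    · obtain ⟨x, hx⟩ := hd u
      refine ⟨x, ?_⟩
      simpa [Finset.sum_add_distrib, hr] using hx
  · intro h r hr
    rw [isRightUnimodular_end_iff] at hr
    obtain ⟨d, hd, hs⟩ := h (LinearMap.lsum R (fun _ => U) ℕ fun i => r i.castSucc)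
      (LinearMap.range (r (Fin.last n))) (by
        refine Submodule.eq_top_iff'.2 fun u => ?_
        obtain ⟨x, rfl⟩ := hr u
        rw [LinearMap.lsum_apply R _ ℕ r, Fin.sum_univ_castSucc]
        exact Submodule.add_mem_sup ⟨fun i => x i.castSucc, by simp⟩ ⟨_, rfl⟩)
    obtain ⟨c, hc⟩ := exists_lift_range _ d hd
    refine ⟨fun i => c ∘ₗ LinearMap.single R (fun _ => U) i,
      (isRightUnimodular_end_iff _).2 fun u => ?_⟩
    obtain ⟨x, rfl⟩ := hs u
    refine ⟨x, ?_⟩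
    simp [Finset.sum_add_distrib, hc, sum_map_single]

end Endomorphisms

/-! ### From stable range conditions to the inequality in `ℕ∞` -/

lemma sr_le {A : Type u} [Ring A] {n : ℕ} (hn : 1 ≤ n) (h : StableRange A n) : sr A ≤ n :=
  sInf_le ⟨n, hn, h, rfl⟩

lemma exists_sr_eq {A : Type u} [Ring A] (h : sr A ≠ ⊤) :
    ∃ s : ℕ, StableRange A (s + 1) ∧ sr A = (s + 1 : ℕ) := by
  have hne : {m : ℕ∞ | ∃ n : ℕ, 1 ≤ n ∧ StableRange A n ∧ m = n}.Nonempty := by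
    by_contra hne
    exact h (by rw [sr, Set.not_nonempty_iff_eq_empty.1 hne, sInf_empty])
  obtain ⟨n, hn, hA, hs⟩ := csInf_mem hne
  obtain ⟨s, rfl⟩ := Nat.exists_eq_add_of_le' hn
  exact ⟨s, hA, hs⟩

lemma sr_le_of_stableRange {A : Type u} {B : Type v} [Ring A] [Ring B] {n : ℕ}
    (h0 : n = 0 → Subsingleton A)
    (h : ∀ s, StableRange A (s + 1) → StableRange B (n * s + 1)) :
    sr B ≤ n * sr A - n + 1 := by
  by_cases hA : sr A = ⊤
  -- In `ℕ∞`, `0 * ⊤ = 0`, so `n = 0` needs the zero ring, whose stable rank is finite.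
  · obtain rfl | hn := n.eq_zero_or_pos
    · have := h0 rfl
      have := hA.ge.trans (sr_le le_rfl (StableRange.of_subsingleton 1))
      simp at this
    · rw [hA, ENat.mul_top (by exact_mod_cast hn.ne')]
      simp
  · obtain ⟨s, hs, he⟩ := exists_sr_eq hA
    refine (sr_le (by omega) (h s hs)).trans ?_
    rw [he]
    norm_cast
    rw [mul_add, mul_one, Nat.add_sub_cancel]

/-! ### Progenerators as mutual summands of powers -/

section RightModules

variable {A : Type u} [Ring A] {P : Type w} [AddCommGroup P] [Module Aᵐᵒᵖ P]

/-- The map `a ↦ x a` from the right regular module. -/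
def rightSpanSingleton (x : P) : A →ₗ[Aᵐᵒᵖ] P where
  toFun a := MulOpposite.op a • x
  map_add' a b := by rw [MulOpposite.op_add, add_smul]
  map_smul' c a := by
    rw [RingHom.id_apply, smul_smul]
    rfl

@[simp]
lemma rightSpanSingleton_apply (x : P) (a : A) :
    rightSpanSingleton x a = MulOpposite.op a • x := rfl

instance projective_right_regular : Module.Projective Aᵐᵒᵖ A := by
  refine Module.Projective.of_split (M := Aᵐᵒᵖ)
    { toFun := MulOpposite.op, map_add' := fun _ _ => rfl, map_smul' := fun _ _ => rfl }
    { toFun := MulOpposite.unop, map_add' := fun _ _ => rfl, map_smul' := fun _ _ => rfl }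
    (LinearMap.ext fun _ => rfl)

lemma surjective_lsum_rightSpanSingleton {n : ℕ} {x : Fin n → P}
    (hx : Submodule.span Aᵐᵒᵖ (Set.range x) = ⊤) :
    Function.Surjective
      (LinearMap.lsum Aᵐᵒᵖ (fun _ : Fin n => A) ℕ fun i => rightSpanSingleton (x i)) := by
  intro p
  obtain ⟨c, hc⟩ := (Submodule.mem_span_range_iff_exists_fun Aᵐᵒᵖ).1 (hx.ge (x := p) trivial)
  exact ⟨fun i => (c i).unop, by simpa using hc⟩

lemma surjective_lsum_of_iSup_range {t : ℕ} {f : Fin t → (P →ₗ[Aᵐᵒᵖ] A)}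
    (hf : (⨆ i, LinearMap.range (f i)) = ⊤) :
    Function.Surjective (LinearMap.lsum Aᵐᵒᵖ (fun _ : Fin t => P) ℕ f) := by
  rw [← LinearMap.range_eq_top, ← top_le_iff, ← hf, iSup_le_iff]
  rintro i _ ⟨p, rfl⟩
  exact ⟨Pi.single i p, LinearMap.lsum_piSingle _ _ _ f i p⟩

lemma IsGenerator.iSup_range (h : IsGenerator A P) :
    (⨆ f : P →ₗ[Aᵐᵒᵖ] A, LinearMap.range f) = ⊤ := by
  set T : Submodule Aᵐᵒᵖ A := ⨆ f : P →ₗ[Aᵐᵒᵖ] A, LinearMap.range f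
  have := h A (A ⧸ T) T.mkQ 0 fun f => LinearMap.ext fun p => by
    simpa using Submodule.mem_iSup_of_mem
      (p := fun f : P →ₗ[Aᵐᵒᵖ] A => LinearMap.range f) f ⟨p, rfl⟩
  rw [← T.ker_mkQ, this, LinearMap.ker_zero]

lemma IsGenerator.exists_fin (h : IsGenerator A P) :
    ∃ (t : ℕ) (f : Fin t → (P →ₗ[Aᵐᵒᵖ] A)), (⨆ i, LinearMap.range (f i)) = ⊤ := by
  obtain ⟨s, hs⟩ := Submodule.mem_iSup_iff_exists_finset.1 (h.iSup_range.ge (x := 1) trivial)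
  refine ⟨s.card, fun i => (s.equivFin.symm i).1, Submodule.eq_top_iff'.2 fun x => ?_⟩
  have h1 : (1 : A) ∈ ⨆ i, LinearMap.range ((s.equivFin.symm i).1) := by
    rw [s.equivFin.symm.iSup_comp (g := fun f => LinearMap.range f.1)]
    rwa [iSup_subtype'] at hs
  simpa using Submodule.smul_mem _ (MulOpposite.op x) h1

lemma IsProgenerator.exists_fin_span (h : IsProgenerator A P) :
    ∃ (n : ℕ) (x : Fin n → P), Submodule.span Aᵐᵒᵖ (Set.range x) = ⊤ :=
  have := h.finite
  Module.Finite.exists_fin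

lemma subsingleton_of_isEmpty_fin {f : Fin 0 → (P →ₗ[Aᵐᵒᵖ] A)}
    (hf : (⨆ i, LinearMap.range (f i)) = ⊤) : Subsingleton A := by
  rw [iSup_of_empty] at hf
  exact (Submodule.subsingleton_iff Aᵐᵒᵖ).1 (subsingleton_of_bot_eq_top hf)

theorem IsProgenerator.stableRange_end (h : IsProgenerator A P) {s t : ℕ}
    {f : Fin t → (P →ₗ[Aᵐᵒᵖ] A)} (hf : (⨆ i, LinearMap.range (f i)) = ⊤)
    (hA : StableRange A (s + 1)) : StableRange (Module.End Aᵐᵒᵖ P) (t * s + 1) := by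
  have := h.projective
  -- Any `k` will do: it does not enter the bound.
  obtain ⟨k, x, hx⟩ := h.exists_fin_span
  rw [stableRange_end_iff]
  exact ((stableRange_end_iff _).1 (hA.of_ringEquiv (RingEquiv.moduleEndSelfOp A))).of_retracts
    (.of_surjective _ (surjective_lsum_rightSpanSingleton hx))
    (.of_surjective _ (surjective_lsum_of_iSup_range hf))

theorem IsProgenerator.stableRange_of_end (h : IsProgenerator A P) {s n : ℕ}
    {x : Fin n → P} (hx : Submodule.span Aᵐᵒᵖ (Set.range x) = ⊤)
    (hP : StableRange (Module.End Aᵐᵒᵖ P) (s + 1)) : StableRange A (n * s + 1) := by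
  have := h.projective
  obtain ⟨t, f, hf⟩ := h.generator.exists_fin
  refine .of_ringEquiv (RingEquiv.moduleEndSelfOp A).symm ((stableRange_end_iff _).2 ?_)
  exact ((stableRange_end_iff _).1 hP).of_retracts
    (.of_surjective _ (surjective_lsum_of_iSup_range hf))
    (.of_surjective _ (surjective_lsum_rightSpanSingleton hx))

end RightModules


/-! ### The progenerator of a Morita equivalence -/

section Morita

open CategoryTheory

lemma iSup_range_eq_top_of_jointly_epi {S : Type*} [Ring S] {ι : Type*} {G X : ModuleCat.{w} S}
    (φ : ι → (G ⟶ X))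
    (h : ∀ (Z : ModuleCat.{w} S) (g g' : X ⟶ Z), (∀ i, φ i ≫ g = φ i ≫ g') → g = g') :
    (⨆ i, LinearMap.range (φ i).hom) = ⊤ := by
  set T : Submodule S X := ⨆ i, LinearMap.range (φ i).hom
  have := h (ModuleCat.of S (X ⧸ T)) (ModuleCat.ofHom T.mkQ) 0 fun i => by
    ext p
    simpa using Submodule.mem_iSup_of_mem (p := fun i => LinearMap.range (φ i).hom) i ⟨p, rfl⟩
  have h0 : T.mkQ = 0 := congrArg ModuleCat.Hom.hom this
  rw [← T.ker_mkQ, h0, LinearMap.ker_zero]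

lemma jointly_epi_of_iSup_range_eq_top {S : Type*} [Ring S] {ι : Type*} {G X : ModuleCat.{w} S}
    (φ : ι → (G ⟶ X)) (h : (⨆ i, LinearMap.range (φ i).hom) = ⊤)
    (Z : ModuleCat.{w} S) (g g' : X ⟶ Z) (hg : ∀ i, φ i ≫ g = φ i ≫ g') : g = g' := by
  have : (⊤ : Submodule S X) ≤ LinearMap.eqLocus g.hom g'.hom := by
    rw [← h, iSup_le_iff]
    rintro i _ ⟨p, rfl⟩
    exact LinearMap.congr_fun (congrArg ModuleCat.Hom.hom (hg i)) p
  ext x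
  exact this trivial

/-- Equivalences of module categories reflect finite generation. -/
lemma finite_of_equivalence {S T : Type*} [Ring S] [Ring T] [Small.{w} S]
    (e : ModuleCat.{w} S ≌ ModuleCat.{w} T) (X : ModuleCat.{w} S)
    [Module.Finite T (e.functor.obj X)] : Module.Finite S X := by
  let G := ModuleCat.of.{w} S (Shrink.{w} S)
  have hG : Module.Finite S G := Module.Finite.equiv (Shrink.linearEquiv S S).symm
  -- The images of the maps `G ⟶ X` cover `e.functor.obj X`; by compactness finitely many suffice,
  -- and faithfulness carries this back to `X`.
  have h1 := iSup_range_eq_top_of_jointly_epi (fun f : G ⟶ X => e.functor.map f)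
    fun Z g g' hg => (e.toAdjunction.homEquiv X Z).injective
      ((ModuleCat.isSeparator S).def _ _ fun f => by
        rw [← Adjunction.homEquiv_naturality_left, ← Adjunction.homEquiv_naturality_left, hg])
  obtain ⟨s, hs⟩ := CompleteLattice.IsCompactElement.exists_finset_of_le_iSup _
    ((Submodule.fg_iff_compact _).1 (Module.Finite.fg_top (R := T) (M := e.functor.obj X))) _ h1.ge
  rw [top_le_iff, iSup_subtype'] at hs
  have h2 := iSup_range_eq_top_of_jointly_epi (fun f : s => f.1) fun Z g g' hg =>
    e.functor.map_injective (jointly_epi_of_iSup_range_eq_top _ hs _ _ _ fun f => by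
      rw [← Functor.map_comp, hg, Functor.map_comp])
  refine ⟨h2 ▸ Submodule.fg_iSup _ fun f => ?_⟩
  rw [LinearMap.range_eq_map]
  exact hG.fg_top.map _

lemma isGenerator_of_isSeparator {A : Type u} [Ring A] {X : ModuleCat.{max u v} Aᵐᵒᵖ}
    (hX : IsSeparator X) : IsGenerator A X := by
  intro M N _ _ _ _ f g h
  let eM := (ULift.moduleEquiv : ULift.{v} M ≃ₗ[Aᵐᵒᵖ] M)
  let eN := (ULift.moduleEquiv : ULift.{v} N ≃ₗ[Aᵐᵒᵖ] N)
  have := hX.def (X := ModuleCat.of Aᵐᵒᵖ (ULift.{v} M)) (Y := ModuleCat.of Aᵐᵒᵖ (ULift.{v} N))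
    (ModuleCat.ofHom (eN.symm.toLinearMap ∘ₗ f ∘ₗ eM.toLinearMap))
    (ModuleCat.ofHom (eN.symm.toLinearMap ∘ₗ g ∘ₗ eM.toLinearMap)) fun k => by
      ext p
      exact (LinearMap.congr_fun (h (eM.toLinearMap ∘ₗ k.hom)) p)
  ext m
  exact congrArg ULift.down
    (LinearMap.congr_fun (congrArg ModuleCat.Hom.hom this) (ULift.up m))

/-- The endomorphism ring of the regular right module, in any universe. -/
noncomputable def endShrinkEquiv (B : Type v) [Ring B] [Small.{w} Bᵐᵒᵖ] :
    B ≃+* Module.End Bᵐᵒᵖ (Shrink.{w} Bᵐᵒᵖ) :=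
  (RingEquiv.opOp B).trans ((RingEquiv.moduleEndSelf Bᵐᵒᵖ).trans
    (Shrink.linearEquiv Bᵐᵒᵖ Bᵐᵒᵖ).symm.conjRingEquiv)

/-- A fully faithful additive functor induces an isomorphism of endomorphism rings. -/
noncomputable def endEquivOfFullyFaithful {S T : Type*} [Ring S] [Ring T]
    {F : ModuleCat.{w} S ⥤ ModuleCat.{w} T} [F.Additive] (hF : F.FullyFaithful)
    (X : ModuleCat.{w} S) : Module.End S X ≃+* Module.End T (F.obj X) :=
  (ModuleCat.endRingEquiv X).symm.trans
    (RingEquiv.trans { hF.mulEquivEnd X with map_add' := fun _ _ => F.map_add }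
      (ModuleCat.endRingEquiv (F.obj X)))

theorem exists_isProgenerator {A : Type u} {B : Type v} [Ring A] [Ring B]
    (hAB : IsMoritaEquivalent ℤ Aᵐᵒᵖ Bᵐᵒᵖ) :
    ∃ (P : Type (max u v)) (_ : AddCommGroup P) (_ : Module Aᵐᵒᵖ P),
      IsProgenerator A P ∧ Nonempty (B ≃+* Module.End Aᵐᵒᵖ P) := by
  obtain ⟨⟨e⟩⟩ := hAB.symm
  have : Small.{max u v} Bᵐᵒᵖ := small_lift.{v, u, v} Bᵐᵒᵖ
  have : Small.{max u v} Aᵐᵒᵖ := small_lift.{u, v, u} Aᵐᵒᵖ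
  let X := ModuleCat.of.{max u v} Bᵐᵒᵖ (Shrink.{max u v} Bᵐᵒᵖ)
  let P := e.eqv.functor.obj X
  have hX : Module.Finite Bᵐᵒᵖ X := Module.Finite.equiv (Shrink.linearEquiv Bᵐᵒᵖ Bᵐᵒᵖ).symm
  have hP : Projective P := (e.eqv.map_projective_iff X).2 inferInstance
  refine ⟨P, inferInstance, inferInstance, ⟨?_, inferInstance, ?_⟩, ⟨?_⟩⟩
  · have : Module.Finite Bᵐᵒᵖ (e.eqv.symm.functor.obj P) :=
      hX.equiv (e.eqv.unitIso.app X).toLinearEquiv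
    exact finite_of_equivalence e.eqv.symm P
  · exact isGenerator_of_isSeparator ((ModuleCat.isSeparator Bᵐᵒᵖ).of_equivalence e.eqv)
  · exact (endShrinkEquiv B).trans
      (endEquivOfFullyFaithful e.eqv.fullyFaithfulFunctor X)

end Morita

end BassStableRank

/-- Morita equivalence is equivalence of the categories of right modules. In `Module.End Aᵐᵒᵖ P`
the product is composition, so that endomorphisms act on the left of the right `A`-module `P`.
Since `1 ≤ sr`, the subtractions in `ℕ∞` do not truncate. -/
theorem theorem9 {A : Type u} {B : Type v} [Ring A] [Ring B]
    (hAB : IsMoritaEquivalent ℤ Aᵐᵒᵖ Bᵐᵒᵖ) :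
    (∃ (P : Type (max u v)) (_ : AddCommGroup P) (_ : Module Aᵐᵒᵖ P),
      BassStableRank.IsProgenerator A P ∧ Nonempty (B ≃+* Module.End Aᵐᵒᵖ P)) ∧
    ∀ (P : Type w) [AddCommGroup P] [Module Aᵐᵒᵖ P],
      BassStableRank.IsProgenerator A P → Nonempty (B ≃+* Module.End Aᵐᵒᵖ P) →
        (∀ n : ℕ, (∃ x : Fin n → P, Submodule.span Aᵐᵒᵖ (Set.range x) = ⊤) →
          BassStableRank.sr A ≤ n * BassStableRank.sr B - n + 1) ∧
        (∀ t : ℕ, (∃ f : Fin t → (P →ₗ[Aᵐᵒᵖ] A), (⨆ i, LinearMap.range (f i)) = ⊤) →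
          BassStableRank.sr B ≤ t * BassStableRank.sr A - t + 1) := by
  refine ⟨BassStableRank.exists_isProgenerator hAB, fun P _ _ hP ⟨e⟩ => ⟨?_, ?_⟩⟩
  · rintro n ⟨x, hx⟩
    refine BassStableRank.sr_le_of_stableRange ?_ fun s hs =>
      hP.stableRange_of_end hx (hs.of_ringEquiv e)
    -- No generators means `P = 0`, so `B ≅ End P` is the zero ring.
    rintro rfl
    rw [Set.range_eq_empty, Submodule.span_empty] at hx
    have : Subsingleton P :=
      (Submodule.subsingleton_iff Aᵐᵒᵖ).1 (subsingleton_of_bot_eq_top hx)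
    exact e.toEquiv.subsingleton
  · rintro t ⟨f, hf⟩
    refine BassStableRank.sr_le_of_stableRange ?_ fun s hs =>
      (hP.stableRange_end hf hs).of_ringEquiv e.symm
    rintro rfl
    exact BassStableRank.subsingleton_of_isEmpty_fin hf
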